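/- Let $M$ be a (Hausdorff, finite-dimensional) smooth manifold and let $A\to M$ be a smooth real vector bundle of finite rank with a Lie algebroid structure: a Lie bracket $[\cdot,\cdot]$ on $\Gamma(A)$ and an anchor $\rho:A\to TM$ with $[X,fY]=f[X,Y]+(\rho(X)f)Y$. Let $d$ be the Lie algebroid differential on $\Gamma(\wedge^\bullet A^*)$. Let $\pi\in\Gamma(\wedge^2A)$ be a Poisson structure ($[\pi,\pi]=0$ for the Schouten–Nijenhuis bracket) and let $\omega\in\Gamma(\wedge^2A^*)$ be a presymplectic structure ($d\omega=0$). Write also $\pi:A^*\to A$, $\pi\xi=i_\xi\pi$, and $\omega:A\to A^*$, $\omega x=-i_x\omega$, and set $N=\pi\circ\omega:A\to A$. Let $\omega_N$ be the 2-form whose bundle map is $\omega\circ N=\omega\circ\pi\circ\omega$. The pair $(\pi,\omega)$ is a $P\Omega$-structure if $\pi$ is Poisson and both $\omega$ and $\omega_N$ are closed. A Dirac structure on $A$ is a maximally isotropic smooth subbundle $L\subset A\oplus A^*$, for the canonical pairing $\langle x+\xi,y+\eta\rangle=\xi(y)+\eta(x)$, whose sections are closed under the Dorfman bracket $[X+\xi,Y+\eta]=[X,Y]+\mathcal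 L_X\eta-i_Y(d\xi)$. Two Dirac structures $L,L'$ are a Dirac pair if the relation $$\mathbf N_{L,L'}=\{(x,y)\in A\times A\mid \exists\,\xi\in A^*,\ (x,\xi)\in L',\ (y,\xi)\in L\}$$ is a Nijenhuis relation. Here a relation $\mathbf N\subset A\times A$ (fibrewise over $M$), with dual $\mathbf N^*=\{(\beta,\alpha)\in A^*\times A^*\mid \alpha(u)=\beta(v)\ \forall (u,v)\in\mathbf N\}$, is a Nijenhuis relation if $$\langle\alpha,[v_1,v_2]\rangle-\langle\alpha',[v_1,u_2]+[u_1,v_2]\rangle+\langle\alpha'',[u_1,u_2]\rangle=0$$ for all sections $u_i,v_i$ of $A$ and $\alpha,\alpha',\alpha''$ of $A^*$ such that $(u_1,v_1)$ and $(u_2,v_2)$ take values in $\mathbf N$ and $(\alpha,\alpha')$ and $(\alpha',\alpha'')$ take values in $\mathbf N^*$. The graphs of $\pi$ and $\omega$, viewed in $A\oplus A^*$, are $L_\pi=\{(\pi\xi,\xi)\mid\xi\in A^*\}$ and $L_\omega=\{(x,\omega x)\mid x\in A\}$. Then $(L_\pi,L_\omega)$ is a Dirac pair if and only if $N=\pi\circ\omega$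 is a Nijenhuis tensor, that is, $[NX,NY]-N([NX,Y]+[X,NY])+N^2[X,Y]=0$ for all $X,Y\in\Gamma(A)$. Moreover: (i) If $\pi$ and $\omega$ constitute a $P\Omega$-structure, then their graphs $(L_\pi,L_\omega)$ constitute a Dirac pair. (ii) Conversely, if the graphs $(L_\pi,L_\omega)$ constitute a Dirac pair and $\pi$ is non-degenerate (i.e. $\pi:A^*\to A$ is an isomorphism), then $\pi$ and $\omega$ constitute a $P\Omega$-structure. -/

import Mathlib

open Bundle
open scoped Manifold ContDiff Topology

noncomputable section
namespace LieAlgd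

variable {E : Type*} [NormedAddCommGroup E] [NormedSpace ℝ E]
  {H : Type*} [TopologicalSpace H] {I : ModelWithCorners ℝ E H}
  {M : Type*} [TopologicalSpace M] [ChartedSpace H M]
  {F : Type*} [NormedAddCommGroup F] [NormedSpace ℝ F]
  {A : M → Type*} [TopologicalSpace (TotalSpace F A)] [∀ x, AddCommGroup (A x)]
  [∀ x, Module ℝ (A x)] [∀ x, TopologicalSpace (A x)] [FiberBundle F A]

section hom
variable {F₁ F₂ F₃ : Type*} [NormedAddCommGroup F₁] [NormedSpace ℝ F₁]
  [NormedAddCommGroup F₂] [NormedSpace ℝ F₂] [NormedAddCommGroup F₃] [NormedSpace ℝ F₃]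
  {A₁ A₂ A₃ : M → Type*}
  [TopologicalSpace (TotalSpace F₁ A₁)] [∀ x, AddCommGroup (A₁ x)] [∀ x, Module ℝ (A₁ x)]
  [∀ x, TopologicalSpace (A₁ x)] [FiberBundle F₁ A₁] [VectorBundle ℝ F₁ A₁]
  [TopologicalSpace (TotalSpace F₂ A₂)] [∀ x, AddCommGroup (A₂ x)] [∀ x, Module ℝ (A₂ x)]
  [∀ x, TopologicalSpace (A₂ x)] [FiberBundle F₂ A₂] [VectorBundle ℝ F₂ A₂]
  [∀ x, IsTopologicalAddGroup (A₂ x)] [∀ x, ContinuousSMul ℝ (A₂ x)]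
  [TopologicalSpace (TotalSpace F₃ A₃)] [∀ x, AddCommGroup (A₃ x)] [∀ x, Module ℝ (A₃ x)]
  [∀ x, TopologicalSpace (A₃ x)] [FiberBundle F₃ A₃] [VectorBundle ℝ F₃ A₃]
  [∀ x, IsTopologicalAddGroup (A₃ x)] [∀ x, ContinuousSMul ℝ (A₃ x)]

/-- Composition of smooth vector bundle morphisms over the identity. -/
def homComp (φ : Cₛ^∞⟮I; F₂ →L[ℝ] F₃, fun x => A₂ x →L[ℝ] A₃ x⟯)
    (ψ : Cₛ^∞⟮I; F₁ →L[ℝ] F₂, fun x => A₁ x →L[ℝ] A₂ x⟯) :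
    Cₛ^∞⟮I; F₁ →L[ℝ] F₃, fun x => A₁ x →L[ℝ] A₃ x⟯ where
  toFun x := (φ x).comp (ψ x)
  contMDiff_toFun := by
    intro x₀
    have h1 := (contMDiffAt_hom_bundle _).1 (φ.contMDiff x₀)
    have h2 := (contMDiffAt_hom_bundle _).1 (ψ.contMDiff x₀)
    refine (contMDiffAt_hom_bundle _).2 ⟨contMDiffAt_id, ?_⟩
    refine (h1.2.clm_comp h2.2).congr_of_eventuallyEq ?_
    filter_upwards [(trivializationAt F₂ A₂ x₀).open_baseSet.mem_nhds
      (FiberBundle.mem_baseSet_trivializationAt' x₀)] with x hx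
    ext v
    exact congrArg (fun w => (trivializationAt F₃ A₃ x₀).continuousLinearMapAt ℝ x (φ x w))
      (Trivialization.symmL_continuousLinearMapAt (R := ℝ) _ hx _).symm

/-- The action of a smooth vector bundle morphism on sections. -/
def homApply (φ : Cₛ^∞⟮I; F₁ →L[ℝ] F₂, fun x => A₁ x →L[ℝ] A₂ x⟯) (X : Cₛ^∞⟮I; F₁, A₁⟯) :
    Cₛ^∞⟮I; F₂, A₂⟯ where
  toFun x := φ x (X x)
  contMDiff_toFun := φ.contMDiff.clm_bundle_apply X.contMDiff

end hom

variable (I F A) in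
/-- Smooth sections of the vector bundle `A`. -/
abbrev Sec := Cₛ^∞⟮I; F, A⟯

variable (I F A) in
/-- Smooth sections of the dual bundle, i.e. 1-forms on `A`. -/
abbrev DualSec [VectorBundle ℝ F A] := Cₛ^∞⟮I; F →L[ℝ] ℝ, fun x => A x →L[ℝ] ℝ⟯

variable [VectorBundle ℝ F A]

/-- Multiplication of a section by a smooth function. -/
def smulSec (f : C^∞⟮I, M; 𝓘(ℝ, ℝ), ℝ⟯) (X : Sec I F A) : Sec I F A where
  toFun x := f x • X x
  contMDiff_toFun := f.contMDiff.smul_section X.contMDiff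

theorem contMDiff_pairing (ξ : DualSec I F A) (X : Sec I F A) :
    ContMDiff I 𝓘(ℝ, ℝ) ∞ (fun x => ξ x (X x)) := by
  have := ξ.contMDiff.clm_bundle_apply (E₂ := Bundle.Trivial M ℝ) X.contMDiff
  intro x
  exact ((contMDiffAt_section x).1 (this x))

theorem contMDiffOn_symmL_apply [ContMDiffVectorBundle ∞ F A I]
    (t : Trivialization F (TotalSpace.proj : TotalSpace F A → M))
    [MemTrivializationAtlas t] (v : F) :
    ContMDiffOn I (I.prod 𝓘(ℝ, F)) ∞ (fun x => TotalSpace.mk' F x (t.symmL ℝ x v)) t.baseSet := by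
  refine t.contMDiffOn_section_baseSet_iff.2 ((contMDiffOn_const (c := v)).congr fun y hy => ?_)
  simp [t.symmL_apply hy, t.apply_mk_symm hy]

/-- A section over a neighbourhood agrees near the point with a global section. -/
theorem exists_global [FiniteDimensional ℝ E] [T2Space M] [IsManifold I ∞ M] (x₀ : M) {U : Set M} (hU : IsOpen U) (hx : x₀ ∈ U) (s : ∀ x, A x)
    (hs : ContMDiffOn I (I.prod 𝓘(ℝ, F)) ∞ (fun x => TotalSpace.mk' F x (s x)) U) :
    ∃ S : Sec I F A, ∀ᶠ x in 𝓝 x₀, S x = s x := by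
  obtain ⟨f, -, hf⟩ := (SmoothBumpFunction.nhds_basis_tsupport (I := I) x₀).mem_iff.1
    (hU.mem_nhds hx)
  have h := ContMDiffOn.smul_section_of_tsupport (n := ∞) (ψ := f) f.contMDiff.contMDiffOn hU hf hs
  refine ⟨⟨_, h⟩, ?_⟩
  filter_upwards [f.eventuallyEq_one] with x hx
  simp [hx]

section tensorial
variable [FiniteDimensional ℝ E] [FiniteDimensional ℝ F] [T2Space M] [IsManifold I ∞ M]
  [ContMDiffVectorBundle ∞ F A I]

/-- A map from sections of `A` to functions that is linear over smooth functions is near each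
point a combination of coordinate functionals. -/
theorem exists_local_form (θ : Sec I F A → M → ℝ)
    (hadd : ∀ X Y x, θ (X + Y) x = θ X x + θ Y x)
    (hsmul : ∀ f X x, θ (smulSec f X) x = f x * θ X x) (x₀ : M) :
    ∃ S : Fin (Module.finrank ℝ F) → Sec I F A, ∀ᶠ x in 𝓝 x₀, ∀ X : Sec I F A,
      θ X x = ∑ i, (Module.finBasis ℝ F).coord i
        ((trivializationAt F A x₀).continuousLinearMapAt ℝ x (X x)) * θ (S i) x := by
  set t := trivializationAt F A x₀
  set b := Module.finBasis ℝ F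
  have hx₀ : x₀ ∈ t.baseSet := FiberBundle.mem_baseSet_trivializationAt' x₀
  obtain ⟨f, -, hf⟩ := (SmoothBumpFunction.nhds_basis_tsupport (I := I) x₀).mem_iff.1
    (t.open_baseSet.mem_nhds hx₀)
  let S : Fin (Module.finrank ℝ F) → Sec I F A := fun i =>
    ⟨_, ContMDiffOn.smul_section_of_tsupport (n := ∞) (ψ := f) f.contMDiff.contMDiffOn
      t.open_baseSet hf (contMDiffOn_symmL_apply t (b i))⟩
  have hSx : ∀ i x, S i x = f x • t.symmL ℝ x (b i) := fun i x => rfl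
  refine ⟨S, ?_⟩
  have h0 : θ 0 = 0 := by
    funext x
    have := hadd 0 0 x
    simpa using this
  have hsum : ∀ (s : Finset (Fin (Module.finrank ℝ F))) (Y : Fin (Module.finrank ℝ F) → Sec I F A)
      (x : M), θ (∑ i ∈ s, Y i) x = ∑ i ∈ s, θ (Y i) x := by
    intro s Y x
    classical
    induction s using Finset.induction_on with
    | empty => simp [h0]
    | insert a s ha h => rw [Finset.sum_insert ha, Finset.sum_insert ha, hadd, h]
  have hc : ∀ (X : Sec I F A) i, ContMDiffOn I 𝓘(ℝ, ℝ) ∞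
      (fun x => b.coord i (t.continuousLinearMapAt ℝ x (X x))) t.baseSet := by
    intro X i
    have h1 := t.contMDiffOn_section_baseSet_iff.1 (X.contMDiff.contMDiffOn (s := t.baseSet))
    have h2 := (LinearMap.toContinuousLinearMap (b.coord i)).contMDiff (n := ∞)
    refine (h2.comp_contMDiffOn h1).congr fun x hx => ?_
    simp [Trivialization.coe_linearMapAt_of_mem _ hx]
  filter_upwards [f.eventuallyEq_one] with x hx X
  have hx1 : f x = 1 := hx
  let g : Fin (Module.finrank ℝ F) → C^∞⟮I, M; 𝓘(ℝ, ℝ), ℝ⟯ := fun i =>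
    ⟨fun x => f x • b.coord i (t.continuousLinearMapAt ℝ x (X x)), by
      refine contMDiff_of_tsupport fun y hy => ?_
      have hy' : y ∈ t.baseSet := hf (closure_mono (Function.support_smul_subset_left _ _) hy)
      exact f.contMDiff.contMDiffAt.smul
        ((hc X i).contMDiffAt (t.open_baseSet.mem_nhds hy'))⟩
  let f2 : C^∞⟮I, M; 𝓘(ℝ, ℝ), ℝ⟯ := ⟨fun x => f x * f x, f.contMDiff.mul f.contMDiff⟩
  have key : smulSec f2 X = ∑ i, smulSec (g i) (S i) := by
    ext y
    have hs : (∑ i, smulSec (g i) (S i)) y = ∑ i, (smulSec (g i) (S i)) y :=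
      (congrFun (map_sum (ContMDiffSection.coeAddHom I F ∞ A)
        (fun i => smulSec (g i) (S i)) Finset.univ) y).trans (Finset.sum_apply _ _ _)
    rw [hs]
    change (f y * f y) • X y = ∑ i, (f y • b.coord i (t.continuousLinearMapAt ℝ y (X y))) •
      (f y • t.symmL ℝ y (b i))
    by_cases hy : y ∈ t.baseSet
    · have h1 : X y = t.symmL ℝ y (t.continuousLinearMapAt ℝ y (X y)) :=
        (t.symmL_continuousLinearMapAt hy _).symm
      conv_lhs => rw [h1, ← b.sum_repr (t.continuousLinearMapAt ℝ y (X y)), map_sum,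
        Finset.smul_sum]
      refine Finset.sum_congr rfl fun i _ => ?_
      rw [map_smul, smul_smul, smul_smul]
      simp only [Module.Basis.coord_apply, smul_eq_mul]
      congr 1
      ring
    · have : f y = 0 := image_eq_zero_of_notMem_tsupport fun h => hy (hf h)
      simp [this]
  have h1 := hsmul f2 X x
  rw [key, hsum] at h1
  have h2 : f2 x = 1 := by
    change f x * f x = 1
    simp [hx1]
  rw [h2, one_mul] at h1
  rw [← h1]
  refine Finset.sum_congr rfl fun i _ => ?_
  rw [hsmul]
  congr 1
  change f x • b.coord i (t.continuousLinearMapAt ℝ x (X x)) =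
    b.coord i (t.continuousLinearMapAt ℝ x (X x))
  rw [hx1, one_smul]

/-- A `C^∞(M)`-linear map from sections of `A` to smooth functions is given by a smooth section
of the dual bundle. -/
theorem exists_dualSec (θ : Sec I F A → M → ℝ)
    (hadd : ∀ X Y x, θ (X + Y) x = θ X x + θ Y x)
    (hsmul : ∀ f X x, θ (smulSec f X) x = f x * θ X x)
    (hθ : ∀ X, ContMDiff I 𝓘(ℝ, ℝ) ∞ (θ X)) :
    ∃ ζ : DualSec I F A, ∀ X x, ζ x (X x) = θ X x := by
  choose S hS using exists_local_form θ hadd hsmul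
  let b := Module.finBasis ℝ F
  let Z : M → ∀ x, A x →L[ℝ] ℝ := fun x₀ x =>
    (∑ i, θ (S x₀ i) x • LinearMap.toContinuousLinearMap (b.coord i)).comp
      ((trivializationAt F A x₀).continuousLinearMapAt ℝ x)
  have hZ : ∀ x₀, ∀ᶠ x in 𝓝 x₀, ∀ X : Sec I F A, Z x₀ x (X x) = θ X x := by
    intro x₀
    filter_upwards [hS x₀] with x hx X
    rw [hx X]
    simp [Z, b, mul_comm]
  have hsurj : ∀ x (v : A x), ∃ X : Sec I F A, X x = v := by
    intro x v
    have hx : x ∈ (trivializationAt F A x).baseSet := FiberBundle.mem_baseSet_trivializationAt' x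
    obtain ⟨X, hX⟩ := exists_global (I := I) x (trivializationAt F A x).open_baseSet hx _
      (contMDiffOn_symmL_apply _ ((trivializationAt F A x).continuousLinearMapAt ℝ x v))
    refine ⟨X, hX.self_of_nhds.trans ?_⟩
    exact Trivialization.symmL_continuousLinearMapAt _ hx v
  refine ⟨⟨fun x => Z x x, fun x₀ => ?_⟩, fun X x => (hZ x).self_of_nhds X⟩
  refine (contMDiffAt_hom_bundle (E₂ := Bundle.Trivial M ℝ) _).2 ⟨contMDiffAt_id, ?_⟩
  have hsm : ContMDiffAt I 𝓘(ℝ, F →L[ℝ] ℝ) ∞ (fun x =>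
      ∑ i, θ (S x₀ i) x • LinearMap.toContinuousLinearMap (b.coord i)) x₀ :=
    ContMDiffAt.sum fun i _ => ((hθ (S x₀ i)).contMDiffAt).smul contMDiffAt_const
  refine hsm.congr_of_eventuallyEq ?_
  filter_upwards [hZ x₀, (trivializationAt F A x₀).open_baseSet.mem_nhds
      (FiberBundle.mem_baseSet_trivializationAt' x₀)] with x hx hxb
  have hZx : Z x x = Z x₀ x := by
    ext v
    obtain ⟨X, rfl⟩ := hsurj x v
    rw [(hZ x).self_of_nhds X, hx X]
  ext v
  have htriv : ∀ w : ℝ, (trivializationAt ℝ (Bundle.Trivial M ℝ) x₀).continuousLinearMapAt ℝ x w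
      = w := by
    intro w
    simp
  rw [hZx]
  refine (htriv _).trans ?_
  change (∑ i, θ (S x₀ i) x • LinearMap.toContinuousLinearMap (b.coord i))
    ((trivializationAt F A x₀).continuousLinearMapAt ℝ x _) = _
  exact congrArg _ (Trivialization.continuousLinearMapAt_symmL (R := ℝ) _ hxb v)

end tensorial


/-- The derivative of a real function along a tangent vector. -/
def dirDeriv (f : M → ℝ) (x : M) (v : TangentSpace I x) : ℝ := mfderiv I 𝓘(ℝ, ℝ) f x v

variable (I F A) in
/-- A Lie algebroid structure on the smooth vector bundle `A → M`: a Lie bracket on the space of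
smooth sections and a smooth bundle morphism `A → TM` (the anchor) satisfying the Leibniz rule. -/
structure LieAlgebroid [IsManifold I ∞ M] where
  /-- the bracket of sections -/
  bracket : Sec I F A →ₗ[ℝ] Sec I F A →ₗ[ℝ] Sec I F A
  bracket_self : ∀ X, bracket X X = 0
  jacobi : ∀ X Y Z, bracket X (bracket Y Z) = bracket (bracket X Y) Z + bracket Y (bracket X Z)
  /-- the anchor -/
  anchor : Cₛ^∞⟮I; F →L[ℝ] E, fun x => A x →L[ℝ] TangentSpace I x⟯
  leibniz : ∀ (X : Sec I F A) (f : C^∞⟮I, M; 𝓘(ℝ, ℝ), ℝ⟯) (Y : Sec I F A) (x : M),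
    bracket X (smulSec f Y) x =
      f x • bracket X Y x + dirDeriv (I := I) f x (anchor x (X x)) • Y x

namespace LieAlgebroid

variable [IsManifold I ∞ M] (𝒜 : LieAlgebroid I F A)

/-- The derivative `ρ(X) f` of a function along the anchor of a section. -/
def act (X : Sec I F A) (f : M → ℝ) (x : M) : ℝ :=
  dirDeriv (I := I) f x (𝒜.anchor x (X x))

/-- The value `(L_X η)(Z) = ρ(X)(η(Z)) - η([X, Z])` of the Lie derivative of a 1-form. -/
def lieDerivEval (X : Sec I F A) (η : DualSec I F A) (Z : Sec I F A) (x : M) : ℝ :=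
  𝒜.act X (fun y => η y (Z y)) x - η x (𝒜.bracket X Z x)

/-- The value `(dξ)(X, Y) = ρ(X)(ξ(Y)) - ρ(Y)(ξ(X)) - ξ([X, Y])` of the differential of a
1-form. -/
def dOneForm (ξ : DualSec I F A) (X Y : Sec I F A) (x : M) : ℝ :=
  𝒜.act X (fun y => ξ y (Y y)) x - 𝒜.act Y (fun y => ξ y (X y)) x - ξ x (𝒜.bracket X Y x)

theorem contMDiff_act (X : Sec I F A) {f : M → ℝ} (hf : ContMDiff I 𝓘(ℝ, ℝ) ∞ f) :
    ContMDiff I 𝓘(ℝ, ℝ) ∞ (𝒜.act X f) := by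
  have h1 : ContMDiff I.tangent 𝓘(ℝ, ℝ).tangent ∞ (tangentMap I 𝓘(ℝ, ℝ) f) :=
    hf.contMDiff_tangentMap (by simp)
  have h2 := h1.comp (homApply 𝒜.anchor X).contMDiff
  exact (contMDiff_snd_tangentBundle_modelSpace ℝ 𝓘(ℝ, ℝ)).comp h2

theorem act_add (X : Sec I F A) {f g : M → ℝ} (hf : ContMDiff I 𝓘(ℝ, ℝ) ∞ f)
    (hg : ContMDiff I 𝓘(ℝ, ℝ) ∞ g) (x : M) :
    𝒜.act X (fun y => f y + g y) x = 𝒜.act X f x + 𝒜.act X g x := by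
  have h := ((hf.mdifferentiable (by simp) x).hasMFDerivAt.add
    (hg.mdifferentiable (by simp) x).hasMFDerivAt).mfderiv
  exact congrArg (fun L : TangentSpace I x →L[ℝ] ℝ => L (𝒜.anchor x (X x))) h

theorem act_mul (X : Sec I F A) {f g : M → ℝ} (hf : ContMDiff I 𝓘(ℝ, ℝ) ∞ f)
    (hg : ContMDiff I 𝓘(ℝ, ℝ) ∞ g) (x : M) :
    𝒜.act X (fun y => f y * g y) x = f x * 𝒜.act X g x + g x * 𝒜.act X f x := by
  have h := ((hf.mdifferentiable (by simp) x).hasMFDerivAt.mul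
    (hg.mdifferentiable (by simp) x).hasMFDerivAt).mfderiv
  exact congrArg (fun L : TangentSpace I x →L[ℝ] ℝ => L (𝒜.anchor x (X x))) h

theorem act_add_left (X Y : Sec I F A) (f : M → ℝ) (x : M) :
    𝒜.act (X + Y) f x = 𝒜.act X f x + 𝒜.act Y f x := by
  change mfderiv I 𝓘(ℝ, ℝ) f x (𝒜.anchor x (X x + Y x)) = _
  rw [map_add, map_add]
  rfl

theorem act_smul_left (g : C^∞⟮I, M; 𝓘(ℝ, ℝ), ℝ⟯) (X : Sec I F A) (f : M → ℝ) (x : M) :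
    𝒜.act (smulSec g X) f x = g x * 𝒜.act X f x := by
  change mfderiv I 𝓘(ℝ, ℝ) f x (𝒜.anchor x (g x • X x)) = _
  rw [map_smul, map_smul]
  rfl

section
variable [FiniteDimensional ℝ E] [FiniteDimensional ℝ F] [T2Space M]
  [ContMDiffVectorBundle ∞ F A I]

theorem exists_lieDeriv (X : Sec I F A) (η : DualSec I F A) :
    ∃ ζ : DualSec I F A, ∀ Z x, ζ x (Z x) = 𝒜.lieDerivEval X η Z x := by
  refine exists_dualSec _ ?_ ?_ ?_
  · intro Z W x
    have h := 𝒜.act_add X (contMDiff_pairing η Z) (contMDiff_pairing η W) x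
    simp only [lieDerivEval, ContMDiffSection.coe_add, Pi.add_apply, map_add, h]
    ring
  · intro f Z x
    have h := 𝒜.act_mul X f.contMDiff (contMDiff_pairing η Z) x
    have h' : 𝒜.act X (fun y => η y (smulSec f Z y)) x =
        𝒜.act X (fun y => f y * η y (Z y)) x := by
      congr 1
      funext y
      exact map_smul _ _ _
    simp only [lieDerivEval, h', h, 𝒜.leibniz, map_add, map_smul, smul_eq_mul]
    change _ - (_ + 𝒜.act X f x * _) = _
    ring
  · intro Z
    exact (𝒜.contMDiff_act X (contMDiff_pairing η Z)).sub (contMDiff_pairing η (𝒜.bracket X Z))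

theorem exists_interior_d (Y : Sec I F A) (ξ : DualSec I F A) :
    ∃ ζ : DualSec I F A, ∀ Z x, ζ x (Z x) = 𝒜.dOneForm ξ Y Z x := by
  refine exists_dualSec _ ?_ ?_ ?_
  · intro Z W x
    have h := 𝒜.act_add Y (contMDiff_pairing ξ Z) (contMDiff_pairing ξ W) x
    simp only [dOneForm, ContMDiffSection.coe_add, Pi.add_apply, map_add, h, act_add_left]
    ring
  · intro f Z x
    have h := 𝒜.act_mul Y f.contMDiff (contMDiff_pairing ξ Z) x
    have h' : 𝒜.act Y (fun y => ξ y (smulSec f Z y)) x =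
        𝒜.act Y (fun y => f y * ξ y (Z y)) x := by
      congr 1
      funext y
      exact map_smul _ _ _
    simp only [dOneForm, h', h, 𝒜.leibniz, map_add, map_smul, smul_eq_mul, act_smul_left]
    change _ - _ - (_ + 𝒜.act Y f x * _) = _
    ring
  · intro Z
    exact ((𝒜.contMDiff_act Y (contMDiff_pairing ξ Z)).sub
      (𝒜.contMDiff_act Z (contMDiff_pairing ξ Y))).sub (contMDiff_pairing ξ (𝒜.bracket Y Z))

/-- The Lie derivative `L_X η` of a 1-form, as a 1-form. -/
def lieDeriv (X : Sec I F A) (η : DualSec I F A) : DualSec I F A :=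
  (𝒜.exists_lieDeriv X η).choose

theorem lieDeriv_apply (X : Sec I F A) (η : DualSec I F A) (Z : Sec I F A) (x : M) :
    𝒜.lieDeriv X η x (Z x) = 𝒜.lieDerivEval X η Z x :=
  (𝒜.exists_lieDeriv X η).choose_spec Z x

/-- The 1-form `i_Y dξ`. -/
def interiorD (Y : Sec I F A) (ξ : DualSec I F A) : DualSec I F A :=
  (𝒜.exists_interior_d Y ξ).choose

theorem interiorD_apply (Y : Sec I F A) (ξ : DualSec I F A) (Z : Sec I F A) (x : M) :
    𝒜.interiorD Y ξ x (Z x) = 𝒜.dOneForm ξ Y Z x :=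
  (𝒜.exists_interior_d Y ξ).choose_spec Z x

/-- The Dorfman bracket `[X + ξ, Y + η] = [X, Y] + L_X η - i_Y dξ` on sections of `A ⊕ A*`. -/
def dorfman (u v : Sec I F A × DualSec I F A) : Sec I F A × DualSec I F A :=
  (𝒜.bracket u.1 v.1, 𝒜.lieDeriv u.1 v.2 - 𝒜.interiorD v.1 u.2)

end

end LieAlgebroid

/-- A subspace of `V ⊕ V*` is isotropic if the canonical symmetric bilinear form
`⟨v + α, w + β⟩ = α(w) + β(v)` vanishes on it. -/
def IsIsotropic {V : Type*} [AddCommGroup V] [Module ℝ V] [TopologicalSpace V]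
    (W : Submodule ℝ (V × (V →L[ℝ] ℝ))) : Prop :=
  ∀ u ∈ W, ∀ v ∈ W, u.2 v.1 + v.2 u.1 = 0

variable (I F) in
/-- A family of subspaces of the fibres of `A ⊕ A*` is a smooth vector subbundle if near each
point it has a smooth local frame. -/
def IsSmoothSubbundle (L : ∀ x, Submodule ℝ (A x × (A x →L[ℝ] ℝ))) : Prop :=
  ∀ x₀ : M, ∃ (k : ℕ) (U : Set M) (s : Fin k → ∀ x, A x) (σ : Fin k → ∀ x, A x →L[ℝ] ℝ),
    IsOpen U ∧ x₀ ∈ U ∧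
    (∀ i, ContMDiffOn I (I.prod 𝓘(ℝ, F)) ∞ (fun x => TotalSpace.mk' F x (s i x)) U) ∧
    (∀ i, ContMDiffOn I (I.prod 𝓘(ℝ, F →L[ℝ] ℝ)) ∞
      (fun x => TotalSpace.mk' (F →L[ℝ] ℝ) (E := fun y => A y →L[ℝ] ℝ) x (σ i x)) U) ∧
    ∀ x ∈ U, LinearIndependent ℝ (fun i => (s i x, σ i x)) ∧
      Submodule.span ℝ (Set.range fun i => (s i x, σ i x)) = L x

/-- For relations `L, L' ⊂ A × A*`, the relation
`{(u, v) | ∃ ξ, (u, ξ) ∈ L' and (v, ξ) ∈ L}` in `A`. -/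
def diracRelation (L L' : ∀ x, Submodule ℝ (A x × (A x →L[ℝ] ℝ))) (x : M) : Set (A x × A x) :=
  {p | ∃ ξ, (p.1, ξ) ∈ L' x ∧ (p.2, ξ) ∈ L x}

/-- The dual `{(β, α) | α(u) = β(v) for all (u, v) ∈ R}` of a relation `R`. -/
def dualRelation {V : Type*} [AddCommGroup V] [Module ℝ V] [TopologicalSpace V]
    (R : Set (V × V)) : Set ((V →L[ℝ] ℝ) × (V →L[ℝ] ℝ)) :=
  {p | ∀ u v, (u, v) ∈ R → p.2 u = p.1 v}

namespace LieAlgebroid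

variable [IsManifold I ∞ M] (𝒜 : LieAlgebroid I F A)

/-- A relation in `A` is a Nijenhuis relation if its torsion vanishes. -/
def IsNijenhuisRelation (R : ∀ x, Set (A x × A x)) : Prop :=
  ∀ (u₁ v₁ u₂ v₂ : Sec I F A) (α α' α'' : DualSec I F A),
    (∀ x, (u₁ x, v₁ x) ∈ R x) → (∀ x, (u₂ x, v₂ x) ∈ R x) →
    (∀ x, (α x, α' x) ∈ dualRelation (R x)) → (∀ x, (α' x, α'' x) ∈ dualRelation (R x)) →
    ∀ x, α x (𝒜.bracket v₁ v₂ x) - α' x ((𝒜.bracket v₁ u₂ + 𝒜.bracket u₁ v₂) x)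
      + α'' x (𝒜.bracket u₁ u₂ x) = 0

section
variable [FiniteDimensional ℝ E] [FiniteDimensional ℝ F] [T2Space M]
  [ContMDiffVectorBundle ∞ F A I]

/-- Dirac structures: maximally isotropic smooth subbundles of `A ⊕ A*` whose sections are closed
under the Dorfman bracket. -/
structure IsDirac (L : ∀ x, Submodule ℝ (A x × (A x →L[ℝ] ℝ))) : Prop where
  subbundle : IsSmoothSubbundle I F L
  maximal : ∀ x, Maximal IsIsotropic (L x)
  closed : ∀ u v : Sec I F A × DualSec I F A,
    (∀ x, (u.1 x, u.2 x) ∈ L x) → (∀ x, (v.1 x, v.2 x) ∈ L x) →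
    ∀ x, ((𝒜.dorfman u v).1 x, (𝒜.dorfman u v).2 x) ∈ L x

/-- Dirac structures `L`, `L'` form a Dirac pair if the associated relation in `A` is a Nijenhuis
relation. -/
structure IsDiracPair (L L' : ∀ x, Submodule ℝ (A x × (A x →L[ℝ] ℝ))) : Prop where
  left : 𝒜.IsDirac L
  right : 𝒜.IsDirac L'
  nijenhuis : 𝒜.IsNijenhuisRelation (diracRelation L L')

end
end LieAlgebroid

variable (I F A) in
/-- A 2-form `Ω` on `A`, given by the bundle map `u ↦ -i_u Ω` from `A` to `A*`, which is
skew-symmetric: `⟨-i_u Ω, v⟩ = -Ω(u, v) = Ω(v, u)`. -/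
structure TwoForm where
  /-- the bundle map `u ↦ -i_u Ω` -/
  flat : Cₛ^∞⟮I; F →L[ℝ] F →L[ℝ] ℝ, fun x => A x →L[ℝ] A x →L[ℝ] ℝ⟯
  skew : ∀ x (u v : A x), flat x u v = -flat x v u

/-- The value `Ω(u, v)`. -/
def TwoForm.form (Ω : TwoForm I F A) (x : M) (u v : A x) : ℝ := -Ω.flat x u v

/-- The graph `{(u, Ω u)}` of a 2-form as a relation between `A` and `A*`. -/
def TwoForm.graph (Ω : TwoForm I F A) (x : M) : Submodule ℝ (A x × (A x →L[ℝ] ℝ)) :=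
  LinearMap.range (LinearMap.prod LinearMap.id (Ω.flat x : A x →ₗ[ℝ] A x →L[ℝ] ℝ))

variable [∀ x, IsTopologicalAddGroup (A x)] [∀ x, ContinuousSMul ℝ (A x)]

variable (I F A) in
/-- A bivector on `A`, given by the bundle map `ξ ↦ i_ξ π` from `A*` to `A`, which is
skew-symmetric: `π(ξ, η) = ⟨η, i_ξ π⟩ = -π(η, ξ)`. -/
structure Bivector where
  /-- the bundle map `ξ ↦ i_ξ π` -/
  sharp : Cₛ^∞⟮I; (F →L[ℝ] ℝ) →L[ℝ] F, fun x => (A x →L[ℝ] ℝ) →L[ℝ] A x⟯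
  skew : ∀ x (ξ η : A x →L[ℝ] ℝ), η (sharp x ξ) = -ξ (sharp x η)

namespace Bivector

/-- The function `π(ξ, η)`. -/
def eval (P : Bivector I F A) (ξ η : DualSec I F A) (x : M) : ℝ := η x (P.sharp x (ξ x))

/-- The graph of a bivector (transposed), as the relation `{(π ξ, ξ)}` between `A` and `A*`. -/
def graph (P : Bivector I F A) (x : M) : Submodule ℝ (A x × (A x →L[ℝ] ℝ)) :=
  LinearMap.range (LinearMap.prod (P.sharp x : (A x →L[ℝ] ℝ) →ₗ[ℝ] A x) LinearMap.id)

/-- A bivector is non-degenerate if `A* → A` is an isomorphism. -/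
def Nondegenerate (P : Bivector I F A) : Prop := ∀ x, Function.Bijective (P.sharp x)

/-- The bundle endomorphism `N = π ∘ Ω` of `A`. -/
def compForm (P : Bivector I F A) (Ω : TwoForm I F A) :
    Cₛ^∞⟮I; F →L[ℝ] F, fun x => A x →L[ℝ] A x⟯ :=
  homComp P.sharp Ω.flat

end Bivector

/-- The 2-form `Ω_N` for `N = π ∘ Ω`, whose bundle map `A → A*` is `Ω ∘ N = Ω ∘ π ∘ Ω`. -/
def TwoForm.twist (Ω : TwoForm I F A) (P : Bivector I F A) : TwoForm I F A where
  flat := homComp Ω.flat (P.compForm Ω)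
  skew x u v := by
    change Ω.flat x (P.sharp x (Ω.flat x u)) v = -Ω.flat x (P.sharp x (Ω.flat x v)) u
    rw [Ω.skew x _ v, Ω.skew x _ u, P.skew x (Ω.flat x u) (Ω.flat x v)]

namespace LieAlgebroid

variable [IsManifold I ∞ M] (𝒜 : LieAlgebroid I F A)

/-- The value `(dΩ)(X, Y, Z)` of the Lie algebroid differential of a 2-form. -/
def dTwoForm (Ω : TwoForm I F A) (X Y Z : Sec I F A) (x : M) : ℝ :=
  𝒜.act X (fun y => Ω.form y (Y y) (Z y)) x - 𝒜.act Y (fun y => Ω.form y (X y) (Z y)) x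
    + 𝒜.act Z (fun y => Ω.form y (X y) (Y y)) x
    - Ω.form x (𝒜.bracket X Y x) (Z x) + Ω.form x (𝒜.bracket X Z x) (Y x)
    - Ω.form x (𝒜.bracket Y Z x) (X x)

/-- Closed 2-forms, i.e. presymplectic structures. -/
def IsPresymplectic (Ω : TwoForm I F A) : Prop := ∀ X Y Z x, 𝒜.dTwoForm Ω X Y Z x = 0

/-- The Schouten-Nijenhuis bracket `[π, π']` of two bivectors, evaluated on three 1-forms: the
cyclic sum over `(α, β, γ) = (ξ₁, ξ₂, ξ₃)` of
`⟨α, [πβ, π'γ]⟩ + ⟨α, [π'β, πγ]⟩ - ρ(πα)(π'(β, γ)) - ρ(π'α)(π(β, γ))`.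
This is the extension of the bracket of sections as a biderivation; for a decomposable
`π = π' = X ∧ Y` over a point (`ρ = 0`) it is `2 [X, Y] ∧ X ∧ Y`. -/
def schouten (P Q : Bivector I F A) (ξ₁ ξ₂ ξ₃ : DualSec I F A) (x : M) : ℝ :=
  let t : DualSec I F A → DualSec I F A → DualSec I F A → ℝ := fun α β γ =>
    α x (𝒜.bracket (homApply P.sharp β) (homApply Q.sharp γ) x)
      + α x (𝒜.bracket (homApply Q.sharp β) (homApply P.sharp γ) x)
      - 𝒜.act (homApply P.sharp α) (Q.eval β γ) x - 𝒜.act (homApply Q.sharp α) (P.eval β γ) x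
  t ξ₁ ξ₂ ξ₃ + t ξ₂ ξ₃ ξ₁ + t ξ₃ ξ₁ ξ₂

/-- Poisson structures: bivectors with `[π, π] = 0`. -/
def IsPoisson (P : Bivector I F A) : Prop := ∀ ξ₁ ξ₂ ξ₃ x, 𝒜.schouten P P ξ₁ ξ₂ ξ₃ x = 0

/-- A bivector `π` and a 2-form `Ω` define a `PΩ`-structure if `π` is Poisson and both `Ω` and
`Ω_N`, `N = π ∘ Ω`, are closed. -/
structure IsPOmega (P : Bivector I F A) (Ω : TwoForm I F A) : Prop where
  poisson : 𝒜.IsPoisson P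
  closed : 𝒜.IsPresymplectic Ω
  closed_twist : 𝒜.IsPresymplectic (Ω.twist P)

/-- A bundle endomorphism `N` of `A` is a Nijenhuis tensor if its torsion
`[NX, NY] - N([NX, Y] + [X, NY]) + N²[X, Y]` vanishes. -/
def IsNijenhuis (N : Cₛ^∞⟮I; F →L[ℝ] F, fun x => A x →L[ℝ] A x⟯) : Prop :=
  ∀ X Y : Sec I F A,
    𝒜.bracket (homApply N X) (homApply N Y)
      - homApply N (𝒜.bracket (homApply N X) Y + 𝒜.bracket X (homApply N Y))
      + homApply N (homApply N (𝒜.bracket X Y)) = 0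

end LieAlgebroid

end LieAlgd

end

open Bundle
open scoped Manifold ContDiff Topology

noncomputable section
namespace LieAlgd

variable {E : Type*} [NormedAddCommGroup E] [NormedSpace ℝ E]
  {H : Type*} [TopologicalSpace H] {I : ModelWithCorners ℝ E H}
  {M : Type*} [TopologicalSpace M] [ChartedSpace H M]
  {F : Type*} [NormedAddCommGroup F] [NormedSpace ℝ F]
  {A : M → Type*} [TopologicalSpace (TotalSpace F A)] [∀ x, AddCommGroup (A x)]
  [∀ x, Module ℝ (A x)] [∀ x, TopologicalSpace (A x)] [FiberBundle F A] [VectorBundle ℝ F A]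

/-! The relation attached to the two graphs is the graph of `N = π ∘ Ω`, and its dual is the graph
of the transpose of `N`. The torsion of the relation is therefore the torsion of the tensor `N`
paired with an arbitrary 1-form, and 1-forms separate points (`isNijenhuisRelation_graph_iff`).

Both graphs are Dirac structures because their failure to be closed under the Dorfman bracket is
measured by a tensor that vanishes by hypothesis: `dΩ` for the 2-form (`dorfman_flat`), half of `[π,
π]` for the bivector (`dorfman_sharp`). This gives the equivalence.

For the rest, the same two identities evaluate the torsion of `N`. When `π` is Poisson and `Ω` is
closed, all terms without `Ω_N` cancel (`torsion_compForm`), and what is left is `π` applied to the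
Dorfman defect of `Ω_N`, that is, `π(dΩ_N(X, Y, ·))`. So `dΩ_N = 0` makes `N` Nijenhuis, and the
converse holds as soon as `π` is injective. -/

/-! ### Sections through given vectors, and separation of points. -/

/-- Every vector of a smooth vector bundle is the value of a smooth section. -/
theorem exists_sec_eq [FiniteDimensional ℝ E] [T2Space M] [IsManifold I ∞ M]
    [ContMDiffVectorBundle ∞ F A I] (x : M) (v : A x) : ∃ X : Sec I F A, X x = v := by
  have hx : x ∈ (trivializationAt F A x).baseSet := FiberBundle.mem_baseSet_trivializationAt' x
  obtain ⟨X, hX⟩ := exists_global (I := I) x (trivializationAt F A x).open_baseSet hx _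
    (contMDiffOn_symmL_apply _ ((trivializationAt F A x).continuousLinearMapAt ℝ x v))
  exact ⟨X, hX.self_of_nhds.trans (Trivialization.symmL_continuousLinearMapAt _ hx v)⟩

theorem exists_dualSec_eq [FiniteDimensional ℝ E] [T2Space M] [IsManifold I ∞ M]
    [ContMDiffVectorBundle ∞ F A I] (x : M) (ξ : A x →L[ℝ] ℝ) :
    ∃ ζ : DualSec I F A, ζ x = ξ :=
  exists_sec_eq (I := I) (F := F →L[ℝ] ℝ) (A := fun x => A x →L[ℝ] ℝ) x ξ

/-- Continuous functionals separate the points of the fibres of a vector bundle. -/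
theorem fibre_eq_of_forall_dual (F : Type*) [NormedAddCommGroup F] [NormedSpace ℝ F]
    {A : M → Type*} [TopologicalSpace (TotalSpace F A)] [∀ x, AddCommGroup (A x)]
    [∀ x, Module ℝ (A x)] [∀ x, TopologicalSpace (A x)] [FiberBundle F A] [VectorBundle ℝ F A]
    (x : M) {v w : A x} (h : ∀ ξ : A x →L[ℝ] ℝ, ξ v = ξ w) : v = w := by
  have hx : x ∈ (trivializationAt F A x).baseSet := FiberBundle.mem_baseSet_trivializationAt' x
  let e := (trivializationAt F A x).continuousLinearEquivAt ℝ x hx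
  -- Functionals separate points of the normed model fibre; the trivialization pulls them back to
  -- the fibre over `x`.
  refine e.injective ((SeparatingDual.eq_iff_forall_dual_eq (R := ℝ)).2 fun g => ?_)
  exact h (g.comp (e : A x →L[ℝ] F))

/-- A section of `A` is determined by its pairings with 1-forms. -/
theorem sec_apply_eq_of_forall_pairing [FiniteDimensional ℝ E] [T2Space M] [IsManifold I ∞ M]
    [ContMDiffVectorBundle ∞ F A I] (x : M) {v w : A x}
    (h : ∀ ζ : DualSec I F A, ζ x v = ζ x w) : v = w := by
  refine fibre_eq_of_forall_dual F x fun ξ => ?_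
  obtain ⟨ζ, rfl⟩ := exists_dualSec_eq (I := I) (F := F) x ξ
  exact h ζ

theorem dual_eq_of_forall_sec [FiniteDimensional ℝ E] [T2Space M] [IsManifold I ∞ M]
    [ContMDiffVectorBundle ∞ F A I] (x : M) {ξ η : A x →L[ℝ] ℝ}
    (h : ∀ Z : Sec I F A, ξ (Z x) = η (Z x)) : ξ = η := by
  ext v
  obtain ⟨Z, rfl⟩ := exists_sec_eq (I := I) (F := F) x v
  exact h Z

/-- The composition of a 1-form with a bundle endomorphism, i.e. the dual endomorphism. -/
def dualApply [∀ x, IsTopologicalAddGroup (A x)] [∀ x, ContinuousSMul ℝ (A x)]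
    (N : Cₛ^∞⟮I; F →L[ℝ] F, fun x => A x →L[ℝ] A x⟯) (α : DualSec I F A) :
    DualSec I F A :=
  homComp (A₃ := Bundle.Trivial M ℝ) α N

/-! ### Local frames. -/

section frame
variable [FiniteDimensional ℝ F] [ContMDiffVectorBundle ∞ F A I]

variable (F) in
/-- The local frame of a vector bundle given by a trivialization. -/
def localFrame (x₀ : M) (i : Fin (Module.finrank ℝ F)) (x : M) : A x :=
  (trivializationAt F A x₀).symmL ℝ x (Module.finBasis ℝ F i)

theorem localFrame_eq_symm {x₀ x : M} (hx : x ∈ (trivializationAt F A x₀).baseSet) :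
    (fun i => localFrame F (A := A) x₀ i x) =
      ((trivializationAt F A x₀).continuousLinearEquivAt ℝ x hx).symm ∘ Module.finBasis ℝ F := by
  funext i
  refine (ContinuousLinearEquiv.eq_symm_apply _).2 ?_
  rw [Trivialization.coe_continuousLinearEquivAt_eq]
  exact Trivialization.continuousLinearMapAt_symmL _ hx _

theorem localFrame_linearIndependent {x₀ x : M} (hx : x ∈ (trivializationAt F A x₀).baseSet) :
    LinearIndependent ℝ (fun i => localFrame F (A := A) x₀ i x) := by
  let e := (trivializationAt F A x₀).continuousLinearEquivAt ℝ x hx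
  rw [localFrame_eq_symm hx]
  exact (Module.finBasis ℝ F).linearIndependent.map' (e.symm : F →ₗ[ℝ] A x)
    (LinearMap.ker_eq_bot.2 e.symm.injective)

theorem span_localFrame {x₀ x : M} (hx : x ∈ (trivializationAt F A x₀).baseSet) :
    Submodule.span ℝ (Set.range fun i => localFrame F (A := A) x₀ i x) = ⊤ := by
  let e := (trivializationAt F A x₀).continuousLinearEquivAt ℝ x hx
  have h := congrArg (Submodule.map (e.symm : F →ₗ[ℝ] A x)) (Module.finBasis ℝ F).span_eq
  rw [Submodule.map_span, Submodule.map_top, LinearMap.range_eq_top.2 e.symm.surjective,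
    ← Set.range_comp] at h
  rw [localFrame_eq_symm hx]
  exact h

theorem contMDiffOn_localFrame (x₀ : M) (i : Fin (Module.finrank ℝ F)) :
    ContMDiffOn I (I.prod 𝓘(ℝ, F)) ∞
      (fun x => TotalSpace.mk' F x (localFrame F (A := A) x₀ i x))
      (trivializationAt F A x₀).baseSet :=
  contMDiffOn_symmL_apply _ _

end frame

/-- Each graph is the range of an injective linear map out of `A` or `A*`, so a frame of the source
bundle yields a frame of the graph. -/
theorem linearIndependent_and_span_map {V W ι : Type*} [AddCommGroup V] [Module ℝ V]
    [AddCommGroup W] [Module ℝ W] (f : V →ₗ[ℝ] W) (hf : Function.Injective f) {v : ι → V}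
    (hv : LinearIndependent ℝ v) (hs : Submodule.span ℝ (Set.range v) = ⊤) :
    LinearIndependent ℝ (fun i => f (v i)) ∧
      Submodule.span ℝ (Set.range fun i => f (v i)) = LinearMap.range f := by
  refine ⟨hv.map' f (LinearMap.ker_eq_bot.2 hf), ?_⟩
  rw [← Submodule.map_top, ← hs, Submodule.map_span, ← Set.range_comp]
  rfl

/-! ### Graphs as maximally isotropic smooth subbundles. -/

namespace TwoForm

theorem mem_graph (Ω : TwoForm I F A) {x : M} {p : A x × (A x →L[ℝ] ℝ)} :
    p ∈ Ω.graph x ↔ p.2 = Ω.flat x p.1 := by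
  constructor
  · rintro ⟨u, rfl⟩
    rfl
  · intro h
    exact ⟨p.1, Prod.ext rfl h.symm⟩

theorem isSmoothSubbundle_graph [FiniteDimensional ℝ F] [ContMDiffVectorBundle ∞ F A I]
    (Ω : TwoForm I F A) : IsSmoothSubbundle I F Ω.graph := by
  intro x₀
  refine ⟨_, (trivializationAt F A x₀).baseSet, localFrame F x₀,
    fun i x => Ω.flat x (localFrame F x₀ i x), (trivializationAt F A x₀).open_baseSet,
    FiberBundle.mem_baseSet_trivializationAt' x₀, contMDiffOn_localFrame x₀, fun i => ?_,
    fun x hx => ?_⟩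
  · exact ContMDiffOn.clm_bundle_apply (E₂ := fun y => A y →L[ℝ] ℝ) Ω.flat.contMDiff.contMDiffOn
      (contMDiffOn_localFrame x₀ i)
  · exact linearIndependent_and_span_map
      (LinearMap.prod LinearMap.id (Ω.flat x : A x →ₗ[ℝ] A x →L[ℝ] ℝ))
      (fun u v h => congrArg Prod.fst h) (localFrame_linearIndependent hx) (span_localFrame hx)

/-- Isotropy is skew-symmetry. For maximality, orthogonality of `p` to every `(u, Ω u)` already
determines the covector `p.2` from the vector `p.1`. -/
theorem maximal_graph (Ω : TwoForm I F A) (x : M) : Maximal IsIsotropic (Ω.graph x) := by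
  refine ⟨fun u hu v hv => ?_, fun W hW hle p hp => ?_⟩
  · rw [mem_graph] at hu hv
    rw [hu, hv, Ω.skew]
    exact neg_add_cancel _
  · rw [mem_graph]
    ext u
    have h := hW p hp _ (hle (Ω.mem_graph.2 rfl : (u, Ω.flat x u) ∈ Ω.graph x))
    change p.2 u + Ω.flat x u p.1 = 0 at h
    rw [Ω.skew] at h
    linarith

end TwoForm

section bivector
variable [∀ x, IsTopologicalAddGroup (A x)] [∀ x, ContinuousSMul ℝ (A x)]

namespace Bivector

theorem mem_graph (P : Bivector I F A) {x : M} {p : A x × (A x →L[ℝ] ℝ)} :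
    p ∈ P.graph x ↔ p.1 = P.sharp x p.2 := by
  constructor
  · rintro ⟨u, rfl⟩
    rfl
  · intro h
    exact ⟨p.2, Prod.ext h.symm rfl⟩

theorem isSmoothSubbundle_graph [FiniteDimensional ℝ F] [ContMDiffVectorBundle ∞ F A I]
    (P : Bivector I F A) : IsSmoothSubbundle I F P.graph := by
  intro x₀
  -- The graph is parametrized by `A*`, so the frame is taken in the dual bundle.
  let A' : M → Type _ := fun x => A x →L[ℝ] ℝ
  refine ⟨_, (trivializationAt (F →L[ℝ] ℝ) A' x₀).baseSet,
    fun i x => P.sharp x (localFrame (F →L[ℝ] ℝ) (A := A') x₀ i x),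
    localFrame (F →L[ℝ] ℝ) (A := A') x₀,
    (trivializationAt (F →L[ℝ] ℝ) A' x₀).open_baseSet,
    FiberBundle.mem_baseSet_trivializationAt' x₀, fun i => ?_,
    contMDiffOn_localFrame (I := I) (A := A') x₀, fun x hx => ?_⟩
  · exact ContMDiffOn.clm_bundle_apply (E₁ := A') P.sharp.contMDiff.contMDiffOn
      (contMDiffOn_localFrame (I := I) (A := A') x₀ i)
  · exact linearIndependent_and_span_map
      (LinearMap.prod (P.sharp x : (A x →L[ℝ] ℝ) →ₗ[ℝ] A x) LinearMap.id)
      (fun u v h => congrArg Prod.snd h) (localFrame_linearIndependent (A := A') hx)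
      (span_localFrame (A := A') hx)

/-- The argument for 2-forms with `A` and `A*` exchanged; recovering the vector `p.1` from its
pairings requires that functionals separate points of the fibre. -/
theorem maximal_graph (P : Bivector I F A) (x : M) : Maximal IsIsotropic (P.graph x) := by
  refine ⟨fun u hu v hv => ?_, fun W hW hle p hp => ?_⟩
  · rw [mem_graph] at hu hv
    rw [hu, hv, P.skew]
    exact neg_add_cancel _
  · rw [mem_graph]
    refine fibre_eq_of_forall_dual F x fun η => ?_
    have h := hW p hp _ (hle (P.mem_graph.2 rfl : (P.sharp x η, η) ∈ P.graph x))
    change p.2 (P.sharp x η) + η p.1 = 0 at h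
    rw [P.skew]
    linarith

end Bivector

/-! ### The relation of the two graphs and its dual. -/

theorem mem_diracRelation_graph (P : Bivector I F A) (Ω : TwoForm I F A) {x : M} {u v : A x} :
    (u, v) ∈ diracRelation P.graph Ω.graph x ↔ v = P.compForm Ω x u := by
  simp only [diracRelation, Set.mem_ofPred_eq, P.mem_graph, Ω.mem_graph]
  constructor
  · rintro ⟨ξ, rfl, h⟩
    exact h
  · intro h
    exact ⟨_, rfl, h⟩

theorem mem_dualRelation_diracRelation_graph (P : Bivector I F A) (Ω : TwoForm I F A) {x : M}
    {α β : A x →L[ℝ] ℝ} :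
    (β, α) ∈ dualRelation (diracRelation P.graph Ω.graph x) ↔
      ∀ u, α u = β (P.compForm Ω x u) := by
  constructor
  · intro h u
    exact h u _ ((mem_diracRelation_graph P Ω).2 rfl)
  · intro h u v huv
    rw [(mem_diracRelation_graph P Ω).1 huv]
    exact h u

end bivector

/-! ### Nijenhuis relations and Nijenhuis tensors. -/

namespace LieAlgebroid

variable [IsManifold I ∞ M] (𝒜 : LieAlgebroid I F A)

/-- Needed for the sign between `Ω.form` and `Ω.flat`, and for exchanging the arguments of `π` under
a derivative. -/
theorem act_neg (X : Sec I F A) {f g : M → ℝ} (hf : ContMDiff I 𝓘(ℝ, ℝ) ∞ f)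
    (h : ∀ y, g y = -f y) (x : M) : 𝒜.act X g x = -𝒜.act X f x := by
  obtain rfl : g = fun y => (-1 : ℝ) * f y := funext fun y => by rw [h, neg_one_mul]
  have h1 := 𝒜.act_mul X (contMDiff_const (c := (-1 : ℝ))) hf x
  have h2 : 𝒜.act X (fun _ => (-1 : ℝ)) x = 0 := by
    change mfderiv I 𝓘(ℝ, ℝ) (fun _ => (-1 : ℝ)) x _ = 0
    rw [mfderiv_const]
    rfl
  rw [h1, h2]
  ring

theorem bracket_swap (X Y : Sec I F A) : 𝒜.bracket X Y = -𝒜.bracket Y X := by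
  have h := 𝒜.bracket_self (X + Y)
  simp only [map_add, LinearMap.add_apply, 𝒜.bracket_self, zero_add, add_zero] at h
  exact eq_neg_of_add_eq_zero_left (by rwa [add_comm] at h)

section
variable [FiniteDimensional ℝ E] [T2Space M] [ContMDiffVectorBundle ∞ F A I]
  [∀ x, IsTopologicalAddGroup (A x)] [∀ x, ContinuousSMul ℝ (A x)]

/-- In both relations the second entry is a function of the first: `v = N u`, `α' = α ∘ N`, `α'' = α
∘ N ∘ N`. Substituting turns the relation's torsion into `α` applied to the tensor's torsion. -/
theorem isNijenhuisRelation_graph_iff (P : Bivector I F A) (Ω : TwoForm I F A) :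
    𝒜.IsNijenhuisRelation (diracRelation P.graph Ω.graph) ↔ 𝒜.IsNijenhuis (P.compForm Ω) := by
  set N := P.compForm Ω with hN
  have key : ∀ (X Y : Sec I F A) (α : DualSec I F A) (x : M),
      α x ((𝒜.bracket (homApply N X) (homApply N Y)
        - homApply N (𝒜.bracket (homApply N X) Y + 𝒜.bracket X (homApply N Y))
        + homApply N (homApply N (𝒜.bracket X Y))) x) =
      α x (𝒜.bracket (homApply N X) (homApply N Y) x)
        - α x (N x ((𝒜.bracket (homApply N X) Y + 𝒜.bracket X (homApply N Y)) x))
        + α x (N x (N x (𝒜.bracket X Y x))) := by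
    intro X Y α x
    rw [← map_sub, ← map_add]
    rfl
  constructor
  · intro h X Y
    ext1 x
    refine sec_apply_eq_of_forall_pairing (I := I) (F := F) x fun α => ?_
    rw [key]
    refine (h X (homApply N X) Y (homApply N Y) α (dualApply N α) (dualApply N (dualApply N α))
      (fun y => (mem_diracRelation_graph P Ω).2 rfl)
      (fun y => (mem_diracRelation_graph P Ω).2 rfl)
      (fun y => (mem_dualRelation_diracRelation_graph P Ω).2 fun u => rfl)
      (fun y => (mem_dualRelation_diracRelation_graph P Ω).2 fun u => rfl) x).trans ?_
    exact (map_zero (α x)).symm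
  · intro h X NX Y NY α α' α'' hX hY hα hα' x
    obtain rfl : NX = homApply N X := by
      ext1 y
      exact (mem_diracRelation_graph P Ω).1 (hX y)
    obtain rfl : NY = homApply N Y := by
      ext1 y
      exact (mem_diracRelation_graph P Ω).1 (hY y)
    have h1 := (mem_dualRelation_diracRelation_graph P Ω).1 (hα x)
    have h2 := (mem_dualRelation_diracRelation_graph P Ω).1 (hα' x)
    have h3 := key X Y α x
    rw [h X Y] at h3
    -- `α''` becomes `α'` after `N`; then `α'` occurs at two different arguments, hence two uses of
    -- `h1`.
    rw [h2, h1, h1, ← hN, ← h3]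
    exact map_zero (α x)

end

/-! ### The Dorfman bracket on graphs. -/

section
variable [FiniteDimensional ℝ E] [FiniteDimensional ℝ F] [T2Space M]
  [ContMDiffVectorBundle ∞ F A I]

/-- The defect of the graph of a 2-form from being closed under the Dorfman bracket is the
differential of the 2-form. -/
theorem dorfman_flat (Ω : TwoForm I F A) (X Y Z : Sec I F A) (x : M) :
    (𝒜.lieDeriv X (homApply Ω.flat Y) - 𝒜.interiorD Y (homApply Ω.flat X)) x (Z x) =
      Ω.flat x (𝒜.bracket X Y x) (Z x) - 𝒜.dTwoForm Ω X Y Z x := by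
  have hp : ∀ U V : Sec I F A, ContMDiff I 𝓘(ℝ, ℝ) ∞ (fun y => Ω.flat y (U y) (V y)) :=
    fun U V => contMDiff_pairing (homApply Ω.flat U) V
  have hn : ∀ U V W : Sec I F A, 𝒜.act W (fun y => Ω.form y (U y) (V y)) x =
      -𝒜.act W (fun y => Ω.flat y (U y) (V y)) x :=
    fun U V W => 𝒜.act_neg W (hp U V) (fun y => rfl) x
  change 𝒜.lieDeriv X (homApply Ω.flat Y) x (Z x) -
    𝒜.interiorD Y (homApply Ω.flat X) x (Z x) = _
  rw [lieDeriv_apply, interiorD_apply]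
  simp only [dTwoForm, hn, lieDerivEval, dOneForm]
  simp only [TwoForm.form]
  -- The differential has these brackets in the first slot of `Ω`, the Lie derivative and `i_Y d`
  -- have them in the second.
  rw [Ω.skew x (𝒜.bracket X Z x), Ω.skew x (𝒜.bracket Y Z x)]
  change 𝒜.act X (fun y => Ω.flat y (Y y) (Z y)) x - Ω.flat x (Y x) (𝒜.bracket X Z x) -
    (𝒜.act Y (fun y => Ω.flat y (X y) (Z y)) x - 𝒜.act Z (fun y => Ω.flat y (X y) (Y y)) x -
      Ω.flat x (X x) (𝒜.bracket Y Z x)) = _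
  ring

/-- The defect in `dorfman_flat` vanishes. Besides closing the graph under the bracket, this is
applied to `Ω` and to `Ω_N` in the study of the torsion. -/
theorem IsPresymplectic.flat_bracket {𝒜 : LieAlgebroid I F A} {Ω : TwoForm I F A}
    (h : 𝒜.IsPresymplectic Ω) (X Y : Sec I F A) (x : M) :
    Ω.flat x (𝒜.bracket X Y x) =
      (𝒜.lieDeriv X (homApply Ω.flat Y) - 𝒜.interiorD Y (homApply Ω.flat X)) x := by
  refine dual_eq_of_forall_sec (I := I) (F := F) x fun Z => ?_
  rw [dorfman_flat, h, sub_zero]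

theorem IsPresymplectic.isDirac_graph {𝒜 : LieAlgebroid I F A} {Ω : TwoForm I F A}
    (h : 𝒜.IsPresymplectic Ω) : 𝒜.IsDirac Ω.graph where
  subbundle := Ω.isSmoothSubbundle_graph
  maximal := Ω.maximal_graph
  closed := by
    rintro ⟨X, ξ⟩ ⟨Y, η⟩ hu hv x
    obtain rfl : ξ = homApply Ω.flat X := by
      ext1 y
      exact Ω.mem_graph.1 (hu y)
    obtain rfl : η = homApply Ω.flat Y := by
      ext1 y
      exact Ω.mem_graph.1 (hv y)
    exact Ω.mem_graph.2 (h.flat_bracket X Y x).symm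

variable [∀ x, IsTopologicalAddGroup (A x)] [∀ x, ContinuousSMul ℝ (A x)]

/-- The defect of the graph of a bivector from being closed under the Dorfman bracket is half
its Schouten square. -/
theorem dorfman_sharp (P : Bivector I F A) (ξ η ζ : DualSec I F A) (x : M) :
    2 * ζ x (𝒜.bracket (homApply P.sharp ξ) (homApply P.sharp η) x) =
      2 * ζ x (P.sharp x ((𝒜.lieDeriv (homApply P.sharp ξ) η -
        𝒜.interiorD (homApply P.sharp η) ξ) x)) + 𝒜.schouten P P ξ η ζ x := by
  have hn : ∀ (W : Sec I F A) (α β : DualSec I F A), 𝒜.act W (P.eval α β) x =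
      -𝒜.act W (P.eval β α) x := fun W α β =>
    𝒜.act_neg W (contMDiff_pairing α (homApply P.sharp β)) (fun y => P.skew y _ _) x
  have hb : 𝒜.bracket (homApply P.sharp ζ) (homApply P.sharp ξ) x =
      -𝒜.bracket (homApply P.sharp ξ) (homApply P.sharp ζ) x := by
    rw [bracket_swap]
    rfl
  have h : ((𝒜.lieDeriv (homApply P.sharp ξ) η - 𝒜.interiorD (homApply P.sharp η) ξ) x)
      (P.sharp x (ζ x)) =
      (𝒜.act (homApply P.sharp ξ) (P.eval ζ η) x
        - η x (𝒜.bracket (homApply P.sharp ξ) (homApply P.sharp ζ) x))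
      - (𝒜.act (homApply P.sharp η) (P.eval ζ ξ) x - 𝒜.act (homApply P.sharp ζ) (P.eval η ξ) x
        - ξ x (𝒜.bracket (homApply P.sharp η) (homApply P.sharp ζ) x)) := by
    change 𝒜.lieDeriv (homApply P.sharp ξ) η x (homApply P.sharp ζ x) -
      𝒜.interiorD (homApply P.sharp η) ξ x (homApply P.sharp ζ x) = _
    rw [lieDeriv_apply, interiorD_apply]
    rfl
  -- Skew-symmetry moves `π` onto `ζ`, so the 1-form is evaluated on the section `πζ`, where its
  -- defining formula applies. The factor 2 arises because the polarized bracket counts every term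
  -- twice when both bivectors are `P`.
  rw [P.skew, h]
  simp only [schouten]
  rw [hb, hn _ η ζ, hn _ ξ η, map_neg]
  ring

theorem IsPoisson.bracket_sharp {𝒜 : LieAlgebroid I F A} {P : Bivector I F A}
    (h : 𝒜.IsPoisson P) (ξ η : DualSec I F A) (x : M) :
    𝒜.bracket (homApply P.sharp ξ) (homApply P.sharp η) x =
      P.sharp x ((𝒜.lieDeriv (homApply P.sharp ξ) η -
        𝒜.interiorD (homApply P.sharp η) ξ) x) := by
  refine sec_apply_eq_of_forall_pairing (I := I) (F := F) x fun ζ => ?_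
  have := 𝒜.dorfman_sharp P ξ η ζ x
  rw [h, add_zero] at this
  linarith

theorem IsPoisson.isDirac_graph {𝒜 : LieAlgebroid I F A} {P : Bivector I F A}
    (h : 𝒜.IsPoisson P) : 𝒜.IsDirac P.graph where
  subbundle := P.isSmoothSubbundle_graph
  maximal := P.maximal_graph
  closed := by
    rintro ⟨X, ξ⟩ ⟨Y, η⟩ hu hv x
    obtain rfl : X = homApply P.sharp ξ := by
      ext1 y
      exact P.mem_graph.1 (hu y)
    obtain rfl : Y = homApply P.sharp η := by
      ext1 y
      exact P.mem_graph.1 (hv y)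
    exact P.mem_graph.2 (h.bracket_sharp ξ η x)

/-- The hypotheses already make both graphs Dirac, so only the Nijenhuis condition is at stake. -/
theorem isDiracPair_graph_iff {P : Bivector I F A} {Ω : TwoForm I F A} (hP : 𝒜.IsPoisson P)
    (hΩ : 𝒜.IsPresymplectic Ω) :
    𝒜.IsDiracPair P.graph Ω.graph ↔ 𝒜.IsNijenhuis (P.compForm Ω) :=
  ⟨fun h => (𝒜.isNijenhuisRelation_graph_iff P Ω).1 h.nijenhuis, fun h =>
    ⟨hP.isDirac_graph, hΩ.isDirac_graph, (𝒜.isNijenhuisRelation_graph_iff P Ω).2 h⟩⟩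

/-! ### The torsion of `π ∘ Ω` and the differential of `Ω_N`. -/

/-- The torsion of `N = π ∘ Ω` is the image under `π` of the 1-form
`i_Y d(Ω_N X) - L_X (Ω_N Y) + Ω_N [X, Y]`. -/
theorem torsion_compForm {P : Bivector I F A} {Ω : TwoForm I F A} (hP : 𝒜.IsPoisson P)
    (hΩ : 𝒜.IsPresymplectic Ω) (X Y : Sec I F A) (x : M) :
    (𝒜.bracket (homApply (P.compForm Ω) X) (homApply (P.compForm Ω) Y)
      - homApply (P.compForm Ω) (𝒜.bracket (homApply (P.compForm Ω) X) Y
        + 𝒜.bracket X (homApply (P.compForm Ω) Y))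
      + homApply (P.compForm Ω) (homApply (P.compForm Ω) (𝒜.bracket X Y))) x =
    P.sharp x ((Ω.twist P).flat x (𝒜.bracket X Y x) -
      (𝒜.lieDeriv X (homApply (Ω.twist P).flat Y)
        - 𝒜.interiorD Y (homApply (Ω.twist P).flat X)) x) := by
  set N := P.compForm Ω with hN
  have h1 := hP.bracket_sharp (homApply Ω.flat X) (homApply Ω.flat Y) x
  have h2 := hΩ.flat_bracket (homApply N X) Y x
  have h3 := hΩ.flat_bracket X (homApply N Y) x
  change 𝒜.bracket (homApply N X) (homApply N Y) x
    - P.sharp x (Ω.flat x (𝒜.bracket (homApply N X) Y x + 𝒜.bracket X (homApply N Y) x))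
    + P.sharp x ((Ω.twist P).flat x (𝒜.bracket X Y x)) = _
  rw [map_add, h2, h3]
  -- `NX` and `NY` are by definition the images under `π` of `ΩX` and `ΩY`, so the Poisson identity
  -- puts the first bracket in the image of `π` as well.
  refine (congrArg (fun v => v - _ + _) h1).trans ?_
  rw [← map_sub, ← map_add]
  congr 1
  simp only [ContMDiffSection.coe_sub, Pi.sub_apply]
  -- `L_{NX}(ΩY)` and `i_{NY} d(ΩX)` each occur twice with opposite signs; only terms in `Ω ∘ N =
  -- Ω_N` survive.
  change 𝒜.lieDeriv (homApply N X) (homApply Ω.flat Y) x -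
      𝒜.interiorD (homApply N Y) (homApply Ω.flat X) x - (𝒜.lieDeriv (homApply N X)
      (homApply Ω.flat Y) x - 𝒜.interiorD Y (homApply (Ω.twist P).flat X) x +
      (𝒜.lieDeriv X (homApply (Ω.twist P).flat Y) x -
      𝒜.interiorD (homApply N Y) (homApply Ω.flat X) x)) + _ = _
  abel

/-- The covector under `π` in `torsion_compForm` is the Dorfman defect of `Ω_N`, which is zero for
closed `Ω_N`. -/
theorem IsPOmega.isNijenhuis {𝒜 : LieAlgebroid I F A} {P : Bivector I F A} {Ω : TwoForm I F A}
    (h : 𝒜.IsPOmega P Ω) : 𝒜.IsNijenhuis (P.compForm Ω) := by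
  intro X Y
  ext1 x
  rw [𝒜.torsion_compForm h.poisson h.closed, ← h.closed_twist.flat_bracket, sub_self]
  exact map_zero (P.sharp x)

theorem IsNijenhuis.isPresymplectic_twist {𝒜 : LieAlgebroid I F A} {P : Bivector I F A}
    {Ω : TwoForm I F A} (hP : 𝒜.IsPoisson P) (hΩ : 𝒜.IsPresymplectic Ω)
    (hN : 𝒜.IsNijenhuis (P.compForm Ω)) (hnd : P.Nondegenerate) :
    𝒜.IsPresymplectic (Ω.twist P) := by
  intro X Y Z x
  have h := 𝒜.torsion_compForm hP hΩ X Y x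
  rw [hN X Y] at h
  -- Injectivity of `π` strips it from the vanishing torsion, leaving a zero defect for `Ω_N`, which
  -- `dorfman_flat` identifies with `dΩ_N`.
  have h0 := sub_eq_zero.1 ((hnd x).1 (h.symm.trans (map_zero (P.sharp x)).symm))
  have h1 := 𝒜.dorfman_flat (Ω.twist P) X Y Z x
  rw [← h0] at h1
  linarith

end

end LieAlgebroid

end LieAlgd

end

theorem mainTheorem6
    {E : Type*} [NormedAddCommGroup E] [NormedSpace ℝ E] [FiniteDimensional ℝ E]
    {H : Type*} [TopologicalSpace H] {I : ModelWithCorners ℝ E H}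
    {M : Type*} [TopologicalSpace M] [ChartedSpace H M] [IsManifold I ∞ M] [T2Space M]
    {F : Type*} [NormedAddCommGroup F] [NormedSpace ℝ F] [FiniteDimensional ℝ F]
    {A : M → Type*} [TopologicalSpace (TotalSpace F A)] [∀ x, AddCommGroup (A x)]
    [∀ x, Module ℝ (A x)] [∀ x, TopologicalSpace (A x)] [FiberBundle F A] [VectorBundle ℝ F A]
    [∀ x, IsTopologicalAddGroup (A x)] [∀ x, ContinuousSMul ℝ (A x)]
    [ContMDiffVectorBundle ∞ F A I]
    (𝒜 : LieAlgd.LieAlgebroid I F A) (P : LieAlgd.Bivector I F A) (Ω : LieAlgd.TwoForm I F A)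
    (hP : 𝒜.IsPoisson P) (hΩ : 𝒜.IsPresymplectic Ω) :
    (𝒜.IsDiracPair P.graph Ω.graph ↔ 𝒜.IsNijenhuis (P.compForm Ω)) ∧
    (𝒜.IsPOmega P Ω → 𝒜.IsDiracPair P.graph Ω.graph) ∧
    (𝒜.IsDiracPair P.graph Ω.graph → P.Nondegenerate → 𝒜.IsPOmega P Ω) := by
  have hiff := 𝒜.isDiracPair_graph_iff hP hΩ
  exact ⟨hiff, fun h => hiff.2 h.isNijenhuis, fun h hnd =>
    ⟨hP, hΩ, LieAlgd.LieAlgebroid.IsNijenhuis.isPresymplectic_twist hP hΩ (hiff.1 h) hnd⟩⟩
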